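/- Fix a first-order signature with finitely many predicate symbols (each of some finite arity $\ge 0$), finitely many constant symbols and no function symbols. A term is a constant or a variable, and finite sets of atoms are read as conjunctions. In a finite set $F$ of atoms, two variables are connected if they are joined by a finite chain of variables in which any two consecutive ones occur together in an atom of $F$. The connected components of $F$ are the classes of the partition of $F$ in which two distinct atoms lie in the same class if and only if some variable of one is connected to some variable of the other (so an atom without variables is a component by itself). An existential rule $B\to H$ consists of finite sets of atoms $B$ (body) and $H$ (head) and stands for the sentence $\forall \mathbf X\,\exists \mathbf Y\,(B\to H)$, where $\mathbf X$ are the variables of $B$ and $\mathbf Y$ the variables of $H$ that do not occur in $B$. It is called connected linear if every atom of $H$ either contains no variable of $B$, or contains variables of only one connected component of $B$ and this component consists of a single atom. A fact, and likewise a Boolean conjunctive query, is the existential closure of a finite set of atoms. A union of conjunctive queries (UCQ) is a finite disjunction of Boolean conjunctive queries. For a set $R$ of existential rules and a UCQ $Q$, a UCQ $Q'$ is a complete UCQ-rewriting of $Q$ with respect to $R$ if for every set $D$ of facts $$D\models Q' \quad\Longleftrightarrow\quad R, D\models Q .$$ The set $R$ is a finite unification set (fus) if every UCQ has a finite and complete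 UCQ-rewriting with respect to $R$. **Theorem.** Every finite set of connected linear existential rules is a finite unification set. -/

import Mathlib

universe u

namespace ExRule

/-- A first-order signature without function symbols: predicates with arities, and constants. -/
structure Signature where
  Pred : Type u
  arity : Pred → ℕ
  Const : Type u

/-- A term is a constant or a variable; the variables are the natural numbers. -/
inductive FOTerm (σ : Signature.{u}) : Type u
  | const (c : σ.Const) : FOTerm σ
  | var (x : ℕ) : FOTerm σ

/-- An atom `p(t₁, …, tₙ)`, where `n` is the arity of `p` (possibly `0`). -/
structure Atom (σ : Signature.{u}) : Type u where
  pred : σ.Pred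
  args : Fin (σ.arity pred) → FOTerm σ

/-- The variables that occur in an atom. -/
def Atom.vars {σ : Signature.{u}} (a : Atom σ) : Set ℕ :=
  {x | ∃ i, a.args i = FOTerm.var x}

/-- The variables that occur in a set of atoms. -/
def varsOf {σ : Signature.{u}} (F : Set (Atom σ)) : Set ℕ :=
  {x | ∃ a ∈ F, x ∈ a.vars}

/-- A finite conjunction of atoms, given as a finite set; the empty one is `⊤`. -/
abbrev CSF (σ : Signature.{u}) : Type u := Finset (Atom σ)

/-- Two variables are connected in `F` if they are joined by a chain of variables in which any two
consecutive ones occur together in some atom of `F`. -/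
def VarConnected {σ : Signature.{u}} (F : CSF σ) : ℕ → ℕ → Prop :=
  Relation.TransGen fun x y => ∃ a ∈ F, x ∈ a.vars ∧ y ∈ a.vars

/-- The connected component of the atom `a` in `F`: `a` itself and all the atoms of `F` with a
variable connected to a variable of `a`. An atom without variables is a component by itself. -/
def componentOf {σ : Signature.{u}} (F : CSF σ) (a : Atom σ) : Set (Atom σ) :=
  {b | b ∈ F ∧ (b = a ∨ ∃ x ∈ a.vars, ∃ y ∈ b.vars, VarConnected F x y)}

/-- `U` is one of the connected components into which `F` is partitioned. -/
def IsComponent {σ : Signature.{u}} (F : CSF σ) (U : Set (Atom σ)) : Prop :=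
  ∃ a ∈ F, U = componentOf F a

/-- An existential rule `∀ X ∃ Y, body → head`, where `X` are the variables of the body and `Y`
the variables of the head that do not occur in the body. -/
structure Rule (σ : Signature.{u}) : Type u where
  body : CSF σ
  head : CSF σ

/-- Connected linear rules: every head atom either contains no variable of the body, or contains
variables of only one connected component of the body, and that component is a single atom. -/
def Rule.IsConnectedLinear {σ : Signature.{u}} (r : Rule σ) : Prop :=
  ∀ h ∈ r.head,
    h.vars ∩ varsOf (r.body : Set (Atom σ)) = ∅ ∨
    ∃ U, IsComponent r.body U ∧ (∃ a, U = {a}) ∧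
      h.vars ∩ varsOf (r.body : Set (Atom σ)) ⊆ varsOf U

/-- A first-order interpretation of the signature, with a nonempty domain. -/
structure Interp (σ : Signature.{u}) where
  Dom : Type u
  nonempty : Nonempty Dom
  const : σ.Const → Dom
  rel : (p : σ.Pred) → (Fin (σ.arity p) → Dom) → Prop

namespace Interp

variable {σ : Signature.{u}} (I : Interp σ)

/-- The value of a term under an assignment of the variables. -/
def eval (v : ℕ → I.Dom) : FOTerm σ → I.Dom
  | FOTerm.const c => I.const c
  | FOTerm.var x => v x

/-- All atoms of `F` are true under the assignment `v`. -/
def Holds (v : ℕ → I.Dom) (F : CSF σ) : Prop :=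
  ∀ a ∈ F, I.rel a.pred fun i => I.eval v (a.args i)

/-- Truth of the existential closure of `F`, i.e. of `F` as a fact or as a Boolean conjunctive
query. -/
def SatEx (F : CSF σ) : Prop :=
  ∃ v : ℕ → I.Dom, I.Holds v F

/-- Truth of an existential rule. -/
def SatRule (r : Rule σ) : Prop :=
  ∀ v : ℕ → I.Dom, I.Holds v r.body →
    ∃ w : ℕ → I.Dom, (∀ x ∈ varsOf (r.body : Set (Atom σ)), w x = v x) ∧ I.Holds w r.head

end Interp

/-- A (finite) union of Boolean conjunctive queries; the empty one is `⊥`. -/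
abbrev UCQ (σ : Signature.{u}) : Type u := Finset (CSF σ)

/-- `R, D ⊨ Q`: every interpretation in which all the rules of `R` and all the facts of `D` are
true makes one of the conjunctive queries of `Q` true. -/
def Entails {σ : Signature.{u}} (R : Set (Rule σ)) (D : Set (CSF σ)) (Q : UCQ σ) : Prop :=
  ∀ I : Interp σ, (∀ r ∈ R, I.SatRule r) → (∀ F ∈ D, I.SatEx F) → ∃ q ∈ Q, I.SatEx q

/-- `Q'` is a complete UCQ-rewriting of `Q` with respect to `R`: for every set of facts `D`,
`D ⊨ Q'` if and only if `R, D ⊨ Q`. -/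
def IsCompleteRewriting {σ : Signature.{u}} (R : Set (Rule σ)) (Q Q' : UCQ σ) : Prop :=
  ∀ D : Set (CSF σ), Entails ∅ D Q' ↔ Entails R D Q

/-- `R` is a finite unification set: every UCQ has a finite and complete UCQ-rewriting with
respect to `R`. -/
def IsFus {σ : Signature.{u}} (R : Set (Rule σ)) : Prop :=
  ∀ Q : UCQ σ, ∃ Q' : UCQ σ, IsCompleteRewriting R Q Q'

end ExRule

namespace ExRule

/-! Let `K` bound the sizes of the rule bodies and of the disjuncts of `Q`, and `A` the arities.
There are finitely many queries with variables below `K * A`; the rewriting is the disjunction of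
those conjunctions of them that, together with `R`, entail `Q`. Soundness is immediate. For
completeness, take a model `I` of `D`. Some `q` in `Q` holds in the chase of `I`, and has to be
transferred to every model `J` of `R` in which the small queries true in `I` hold. A homomorphism
from the chase to `J` need not exist, but `FinHom` suffices: any `K` facts map to `J`. It holds at
stage 0 by the choice of `K * A`, and chase steps preserve it. Body values in a new fact come from
at most one old fact, so `K` facts rest on at most `K` old ones (`exists_support`). A whole rule
body also has at most `K` atoms, hence maps to `J`; since a one-atom component shares no variable
with the rest, this map can be changed there to agree with the one already chosen
(`exists_head_hom`). -/

/-- A ground fact over a domain `D`: a predicate applied to elements of `D`. -/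
structure GroundFact (σ : Signature.{u}) (D : Type u) : Type u where
  pred : σ.Pred
  args : Fin (σ.arity pred) → D

/-! ### Instances of atoms, local homomorphisms, one-atom components. -/

section Basics

variable {σ : Signature.{u}} {D : Type u}

/-- The value of a term, given the values of the constants and of the variables. -/
def FOTerm.value (c : σ.Const → D) (v : ℕ → D) : FOTerm σ → D
  | FOTerm.const k => c k
  | FOTerm.var x => v x

/-- The instance of an atom under an assignment. -/
def Atom.inst (c : σ.Const → D) (v : ℕ → D) (a : Atom σ) : GroundFact σ D :=
  ⟨a.pred, fun i => (a.args i).value c v⟩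

theorem Interp.eval_eq_value (I : Interp σ) (v : ℕ → I.Dom) (t : FOTerm σ) :
    I.eval v t = t.value I.const v := by
  cases t <;> rfl

theorem Interp.eval_comp (I : Interp σ) {c : σ.Const → D} {g : D → I.Dom}
    (hg : ∀ k, g (c k) = I.const k) (v : ℕ → D) (t : FOTerm σ) :
    I.eval (fun x => g (v x)) t = g (t.value c v) := by
  cases t with
  | const k => exact (hg k).symm
  | var x => rfl

theorem Interp.rel_congr (I : Interp σ) {v w : ℕ → I.Dom} {a : Atom σ}
    (h : ∀ x ∈ a.vars, v x = w x) (hv : I.rel a.pred fun i => I.eval v (a.args i)) :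
    I.rel a.pred fun i => I.eval w (a.args i) := by
  have : (fun i => I.eval w (a.args i)) = fun i => I.eval v (a.args i) := by
    funext i
    cases ht : a.args i with
    | const k => rfl
    | var x => exact (h x ⟨i, ht⟩).symm
  rwa [this]

/-- Every set of at most `K` facts of `F` has a homomorphism to `J` that respects constants. -/
def FinHom (K : ℕ) (c : σ.Const → D) (F : Set (GroundFact σ D)) (J : Interp σ) : Prop :=
  ∀ s : Finset (GroundFact σ D), s.card ≤ K → (∀ f ∈ s, f ∈ F) →
    ∃ g : D → J.Dom, (∀ k, g (c k) = J.const k) ∧ ∀ f ∈ s, J.rel f.pred fun i => g (f.args i)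

theorem FinHom.exists_hom_of_inst {K : ℕ} {c : σ.Const → D} {F : Set (GroundFact σ D)}
    {J : Interp σ} (h : FinHom K c F J) {q : CSF σ} (hq : q.card ≤ K) {v : ℕ → D}
    (hv : ∀ a ∈ q, a.inst c v ∈ F) :
    ∃ g : D → J.Dom, (∀ k, g (c k) = J.const k) ∧ J.Holds (fun x => g (v x)) q := by
  classical
  obtain ⟨g, hc, hg⟩ := h (q.image (Atom.inst c v)) (Finset.card_image_le.trans hq) (by
    intro f hf
    obtain ⟨a, ha, rfl⟩ := Finset.mem_image.1 hf
    exact hv a ha)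
  refine ⟨g, hc, fun a ha => ?_⟩
  have := hg _ (Finset.mem_image_of_mem _ ha)
  simp only [J.eval_comp hc]
  exact this

/-- In a one-atom component, any atom that shares a variable with the atom is that atom. -/
theorem eq_of_isComponent_singleton {B : CSF σ} {a b : Atom σ} (hU : IsComponent B {a})
    (hb : b ∈ B) {x : ℕ} (hxa : x ∈ a.vars) (hxb : x ∈ b.vars) : b = a := by
  obtain ⟨a', ha', hU⟩ := hU
  have h1 : a' ∈ componentOf B a' := ⟨ha', Or.inl rfl⟩
  rw [← hU, Set.mem_singleton_iff] at h1
  subst h1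
  have h2 : b ∈ componentOf B a' :=
    ⟨hb, Or.inr ⟨x, hxa, x, hxb, Relation.TransGen.single ⟨a', ha', hxa, hxa⟩⟩⟩
  rwa [← hU, Set.mem_singleton_iff] at h2

theorem mem_of_isComponent_singleton {B : CSF σ} {a : Atom σ} (hU : IsComponent B {a}) :
    a ∈ B := by
  obtain ⟨a', -, hU⟩ := hU
  have h : a ∈ componentOf B a' := hU ▸ Set.mem_singleton a
  exact h.1

end Basics

/-! ### The oblivious chase of an interpretation. -/

section Chase

/-- The domain of the chase of `I`: the elements of `I`, the constants, and for each stage `n`,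
rule `r` and assignment `v` a null for every variable. -/
inductive ChaseDom {σ : Signature.{u}} (I : Interp σ) : Type u
  | base (d : I.Dom) : ChaseDom I
  | const (k : σ.Const) : ChaseDom I
  | null (n : ℕ) (r : Rule σ) (v : ℕ → ChaseDom I) (x : ℕ) : ChaseDom I

namespace ChaseDom

variable {σ : Signature.{u}} {I : Interp σ}

/-- The first stage at which an element can occur. -/
def stage : ChaseDom I → ℕ
  | base _ => 0
  | const _ => 0
  | null n _ _ _ => n + 1

/-- The retraction of the chase domain to `I`, with a junk value on nulls. -/
noncomputable def proj : ChaseDom I → I.Dom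
  | base d => d
  | const k => I.const k
  | null _ _ _ _ => I.nonempty.some

end ChaseDom

variable {σ : Signature.{u}} (I : Interp σ) (R : Set (Rule σ))

open scoped Classical in
/-- The assignment of the head variables of `r` when `r` is applied at stage `n` along `v`. -/
noncomputable def headAssignment {I : Interp σ} (n : ℕ) (r : Rule σ) (v : ℕ → ChaseDom I)
    (x : ℕ) : ChaseDom I :=
  if x ∈ varsOf (r.body : Set (Atom σ)) then v x else ChaseDom.null n r v x

/-- `v` maps the body of `r` to facts of `F`. -/
def IsTrigger {I : Interp σ} (F : Set (GroundFact σ (ChaseDom I))) (r : Rule σ)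
    (v : ℕ → ChaseDom I) : Prop :=
  ∀ b ∈ r.body, b.inst ChaseDom.const v ∈ F

/-- The facts of the oblivious chase of `I` with the rules `R` at a given stage. -/
def chaseStage : ℕ → Set (GroundFact σ (ChaseDom I))
  | 0 => {f | (∀ i, (f.args i).stage = 0) ∧ I.rel f.pred fun i => (f.args i).proj}
  | n + 1 => chaseStage n ∪ {f | ∃ r ∈ R, ∃ v, IsTrigger (chaseStage n) r v ∧
      ∃ h ∈ r.head, f = h.inst ChaseDom.const (headAssignment n r v)}

/-- The chase of `I` with the rules `R`. -/
def chase : Interp σ where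
  Dom := ChaseDom I
  nonempty := I.nonempty.map ChaseDom.base
  const := ChaseDom.const
  rel p t := ∃ n, ⟨p, t⟩ ∈ chaseStage I R n

theorem chaseStage_mono : Monotone (chaseStage I R) :=
  monotone_nat_of_le_succ fun _ _ hf => Or.inl hf

theorem chase_holds_iff (v : ℕ → ChaseDom I) (q : CSF σ) :
    (chase I R).Holds v q ↔ ∃ n, ∀ a ∈ q, a.inst ChaseDom.const v ∈ chaseStage I R n := by
  have key : ∀ a : Atom σ, ((chase I R).rel a.pred fun i => (chase I R).eval v (a.args i)) ↔
      ∃ n, a.inst ChaseDom.const v ∈ chaseStage I R n := by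
    intro a
    have : (fun i => (chase I R).eval v (a.args i)) = (a.inst ChaseDom.const v).args :=
      funext fun i => (chase I R).eval_eq_value v (a.args i)
    rw [this]
    rfl
  constructor
  · intro h
    choose! n hn using fun a ha => (key a).1 (h a ha)
    exact ⟨q.sup n, fun a ha => chaseStage_mono I R (Finset.le_sup ha) (hn a ha)⟩
  · rintro ⟨n, hn⟩ a ha
    exact (key a).2 ⟨n, hn a ha⟩

theorem chase_satRule {r : Rule σ} (hr : r ∈ R) : (chase I R).SatRule r := by
  intro v hv
  obtain ⟨n, hn⟩ := (chase_holds_iff I R v _).1 hv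
  refine ⟨headAssignment n r v, fun x hx => if_pos hx, (chase_holds_iff I R _ _).2 ⟨n + 1, ?_⟩⟩
  exact fun h hh => Or.inr ⟨r, hr, v, hn, h, hh, rfl⟩

/-- Stage 0 contains every lift of a fact of `I`, an element named by `k` being liftable to `base`
or to `const k`. Keeping these copies apart matters: constants equal in `I` may differ in `J`. -/
theorem chase_satEx {F : CSF σ} (hF : I.SatEx F) : (chase I R).SatEx F := by
  obtain ⟨v, hv⟩ := hF
  refine ⟨fun x => ChaseDom.base (v x), (chase_holds_iff I R _ _).2 ⟨0, fun a ha => ⟨?_, ?_⟩⟩⟩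
  · intro i
    change ChaseDom.stage ((a.args i).value _ _) = 0
    cases a.args i <;> rfl
  · have : (fun i => (((a.inst ChaseDom.const fun x => ChaseDom.base (v x)).args i).proj : I.Dom)) =
        fun i => I.eval v (a.args i) := by
      funext i
      change ChaseDom.proj ((a.args i).value _ _) = _
      cases a.args i <;> rfl
    rw [this]
    exact hv a ha

/-! ### Transfer from the chase to another model of the rules. -/

variable {I R}

theorem stage_le_of_mem_chaseStage {n : ℕ} {f : GroundFact σ (ChaseDom I)}
    (hf : f ∈ chaseStage I R n) (i : Fin (σ.arity f.pred)) : (f.args i).stage ≤ n := by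
  induction n generalizing f with
  | zero => exact (hf.1 i).le
  | succ n ih =>
    rcases hf with hf | ⟨r, -, v, hv, h, -, rfl⟩
    · exact (ih hf i).trans n.le_succ
    · change ChaseDom.stage ((h.args i).value _ _) ≤ n + 1
      cases h.args i with
      | const k => exact Nat.zero_le _
      | var x =>
        change (headAssignment n r v x).stage ≤ n + 1
        unfold headAssignment
        split_ifs with hx
        · obtain ⟨b, hb, j, hj⟩ := hx
          have := ih (hv b hb) j
          simp only [Atom.inst, hj] at this
          exact this.trans n.le_succ
        · exact le_rfl

theorem stage_le_of_isTrigger {n : ℕ} {r : Rule σ} {v : ℕ → ChaseDom I}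
    (hv : IsTrigger (chaseStage I R n) r v) {x : ℕ} (hx : x ∈ varsOf (r.body : Set (Atom σ))) :
    (v x).stage ≤ n := by
  obtain ⟨b, hb, j, hj⟩ := hx
  have := stage_le_of_mem_chaseStage (hv b hb) j
  simp only [Atom.inst, hj] at this
  exact this

/-- Each fact of the next stage depends, apart from nulls, on at most one fact of this stage. -/
theorem exists_support (hR : ∀ r ∈ R, r.IsConnectedLinear) {n : ℕ}
    {f : GroundFact σ (ChaseDom I)} (hf : f ∈ chaseStage I R (n + 1)) :
    ∃ t : Finset (GroundFact σ (ChaseDom I)), t.card ≤ 1 ∧ (∀ e ∈ t, e ∈ chaseStage I R n) ∧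
      (f ∈ t ∨ ∃ r ∈ R, ∃ v, IsTrigger (chaseStage I R n) r v ∧ ∃ h ∈ r.head,
        f = h.inst ChaseDom.const (headAssignment n r v) ∧
        ∀ x ∈ h.vars, x ∈ varsOf (r.body : Set (Atom σ)) →
          ∃ a, IsComponent r.body {a} ∧ x ∈ a.vars ∧ a.inst ChaseDom.const v ∈ t) := by
  rcases hf with hf | ⟨r, hr, v, hv, h, hh, rfl⟩
  · exact ⟨{f}, by simp, by simpa using hf, Or.inl (by simp)⟩
  · rcases hR r hr h hh with h0 | ⟨U, hU, ⟨a, rfl⟩, hsub⟩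
    · refine ⟨∅, by simp, by simp, Or.inr ⟨r, hr, v, hv, h, hh, rfl, fun x hx hx' => ?_⟩⟩
      exact (h0.le ⟨hx, hx'⟩).elim
    · refine ⟨{a.inst ChaseDom.const v}, by simp, ?_,
        Or.inr ⟨r, hr, v, hv, h, hh, rfl, fun x hx hx' => ?_⟩⟩
      · intro e he
        rw [Finset.mem_singleton.1 he]
        exact hv a (mem_of_isComponent_singleton hU)
      · obtain ⟨b, rfl, hb⟩ := hsub ⟨hx, hx'⟩
        exact ⟨b, hU, hb, by simp⟩

/-- A homomorphism on some facts extends to the head of a trigger, provided it is prescribed only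
on one-atom components of the body. -/
theorem exists_head_hom {K : ℕ} {J : Interp σ} {F : Set (GroundFact σ (ChaseDom I))}
    (hF : FinHom K ChaseDom.const F J) {r : Rule σ} (hr : J.SatRule r) (hK : r.body.card ≤ K)
    {v : ℕ → ChaseDom I} (hv : IsTrigger F r v) {s : Finset (GroundFact σ (ChaseDom I))}
    {g : ChaseDom I → J.Dom} (hc : ∀ k, g (ChaseDom.const k) = J.const k)
    (hg : ∀ f ∈ s, J.rel f.pred fun i => g (f.args i)) :
    ∃ w : ℕ → J.Dom, J.Holds w r.head ∧ ∀ a, IsComponent r.body {a} →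
      a.inst ChaseDom.const v ∈ s → ∀ x ∈ a.vars, w x = g (v x) := by
  classical
  obtain ⟨g', -, hg'⟩ := hF.exists_hom_of_inst hK hv
  let used : Atom σ → Prop := fun a => IsComponent r.body {a} ∧ a.inst ChaseDom.const v ∈ s
  -- `g` is prescribed on the used components; `g'` fills in the rest of the body.
  let v' : ℕ → J.Dom := fun x => if ∃ a, used a ∧ x ∈ a.vars then g (v x) else g' (v x)
  have hv' : J.Holds v' r.body := by
    intro b hb
    by_cases hu : used b
    · refine J.rel_congr (v := fun x => g (v x)) (fun x hx => (if_pos ⟨b, hu, hx⟩).symm) ?_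
      have := hg _ hu.2
      simp only [J.eval_comp hc]
      exact this
    · refine J.rel_congr (v := fun x => g' (v x)) (fun x hx => (if_neg ?_).symm) (hg' b hb)
      rintro ⟨a, ha, hxa⟩
      exact hu (eq_of_isComponent_singleton ha.1 hb hxa hx ▸ ha)
  obtain ⟨w, hw, hh⟩ := hr v' hv'
  refine ⟨w, hh, fun a ha has x hx => ?_⟩
  rw [hw x ⟨a, mem_of_isComponent_singleton ha, hx⟩]
  exact if_pos ⟨a, ⟨ha, has⟩, hx⟩

/-- Map the supports of the given facts by some `g`, then send the nulls created at this stage to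
the witnesses that the rules provide in `J`. -/
theorem FinHom.chaseStage_succ {K : ℕ} {J : Interp σ} (hR : ∀ r ∈ R, r.IsConnectedLinear)
    (hK : ∀ r ∈ R, r.body.card ≤ K) (hJ : ∀ r ∈ R, J.SatRule r) {n : ℕ}
    (hn : FinHom K ChaseDom.const (chaseStage I R n) J) :
    FinHom K ChaseDom.const (chaseStage I R (n + 1)) J := by
  classical
  intro s hs hsF
  choose! t ht1 htn ht using fun f hf => exists_support hR (hsF f hf)
  -- At most one supporting fact for each fact of `s`, so the bound `K` does not grow.
  obtain ⟨g, hc, hg⟩ := hn (s.biUnion t)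
    ((Finset.card_biUnion_le_card_mul s t 1 ht1).trans (by simpa using hs)) (by
      intro e he
      obtain ⟨f, hf, he⟩ := Finset.mem_biUnion.1 he
      exact htn f hf e he)
  -- One `w` per trigger, so that facts of `s` sharing a null agree on it.
  have hw : ∀ (r : Rule σ) (v : ℕ → ChaseDom I), ∃ w : ℕ → J.Dom,
      r ∈ R ∧ IsTrigger (chaseStage I R n) r v → J.Holds w r.head ∧ ∀ a, IsComponent r.body {a} →
        a.inst ChaseDom.const v ∈ s.biUnion t → ∀ x ∈ a.vars, w x = g (v x) := by
    intro r v
    by_cases h : r ∈ R ∧ IsTrigger (chaseStage I R n) r v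
    · obtain ⟨w, hw⟩ := exists_head_hom hn (hJ r h.1) (hK r h.1) h.2 hc hg
      exact ⟨w, fun _ => hw⟩
    · exact ⟨fun _ => J.nonempty.some, fun h' => (h h').elim⟩
  choose w hw using hw
  let G : ChaseDom I → J.Dom := fun d =>
    match d with
    | ChaseDom.null m r v x => if m = n then w r v x else g (ChaseDom.null m r v x)
    | d => g d
  have hGg : ∀ d : ChaseDom I, d.stage ≤ n → G d = g d := by
    intro d hd
    cases d with
    | base d => rfl
    | const k => rfl
    | null m r v x => exact if_neg (Nat.ne_of_lt hd)
  refine ⟨G, hc, fun f hf => ?_⟩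
  rcases ht f hf with hft | ⟨r, hr, v, hv, h, hh, rfl, hsupp⟩
  · have : (fun i => G (f.args i)) = fun i => g (f.args i) :=
      funext fun i => hGg _ (stage_le_of_mem_chaseStage (htn f hf f hft) i)
    rw [this]
    exact hg f (Finset.mem_biUnion.2 ⟨f, hf, hft⟩)
  · obtain ⟨hhead, hfr⟩ := hw r v ⟨hr, hv⟩
    have : (fun i => G ((h.args i).value ChaseDom.const (headAssignment n r v))) =
        fun i => J.eval (w r v) (h.args i) := by
      funext i
      cases hi : h.args i with
      | const k => exact hc k
      | var x =>
        change G (headAssignment n r v x) = w r v x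
        unfold headAssignment
        split_ifs with hx
        · obtain ⟨a, ha, hxa, hat⟩ := hsupp x ⟨i, hi⟩ hx
          rw [hGg _ (stage_le_of_isTrigger hv hx),
            hfr a ha (Finset.mem_biUnion.2 ⟨_, hf, hat⟩) x hxa]
        · exact if_pos rfl
    change J.rel h.pred fun i => G ((h.args i).value ChaseDom.const (headAssignment n r v))
    rw [this]
    exact hhead h hh

theorem chase_satEx_transfer {K : ℕ} {J : Interp σ} (hR : ∀ r ∈ R, r.IsConnectedLinear)
    (hK : ∀ r ∈ R, r.body.card ≤ K) (hJ : ∀ r ∈ R, J.SatRule r)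
    (h0 : FinHom K ChaseDom.const (chaseStage I R 0) J) {q : CSF σ} (hq : q.card ≤ K)
    (hIq : (chase I R).SatEx q) : J.SatEx q := by
  have hall : ∀ n, FinHom K ChaseDom.const (chaseStage I R n) J := by
    intro n
    induction n with
    | zero => exact h0
    | succ n ih => exact ih.chaseStage_succ hR hK hJ
  obtain ⟨v, hv⟩ := hIq
  obtain ⟨n, hn⟩ := (chase_holds_iff I R v q).1 hv
  obtain ⟨g, -, hg⟩ := (hall n).exists_hom_of_inst hq hn
  exact ⟨_, hg⟩

/-- If every query with variables below `N` that is true in `I` is true in `J`, then few facts of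
`I` have a homomorphism to `J`. -/
theorem finHom_chaseStage_zero {J : Interp σ} {K A : ℕ} (hA : ∀ p, σ.arity p ≤ A)
    (hIJ : ∀ q : CSF σ, (∀ a ∈ q, ∀ x ∈ a.vars, x < K * A) → I.SatEx q → J.SatEx q) :
    FinHom K ChaseDom.const (chaseStage I R 0) J := by
  classical
  intro s hs hsF
  let E : Finset (ChaseDom I) := s.biUnion fun f => Finset.univ.image f.args
  have hE : E.card ≤ K * A := by
    refine (Finset.card_biUnion_le_card_mul s _ A fun f _ => ?_).trans (Nat.mul_le_mul_right A hs)
    exact Finset.card_image_le.trans (by simpa using hA f.pred)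
  let e := E.equivFin
  let idx : ChaseDom I → ℕ := fun d => if h : d ∈ E then (e ⟨d, h⟩ : ℕ) else 0
  have hidx : ∀ d ∈ E, idx d < K * A := by
    intro d hd
    simp only [idx, dif_pos hd]
    exact (e ⟨d, hd⟩).2.trans_le hE
  have hinj : Set.InjOn idx E := by
    intro d hd d' hd' hdd
    rw [Finset.mem_coe] at hd hd'
    simp only [idx, dif_pos hd, dif_pos hd'] at hdd
    simpa using e.injective (Fin.ext hdd)
  -- Reads `s` as a query: constants stay, the at most `K * A` other arguments become variables.
  let term : ChaseDom I → FOTerm σ := fun d =>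
    match d with
    | ChaseDom.const k => FOTerm.const k
    | d => FOTerm.var (idx d)
  let atom : GroundFact σ (ChaseDom I) → Atom σ := fun f => ⟨f.pred, fun i => term (f.args i)⟩
  have hmem : ∀ f ∈ s, ∀ i, f.args i ∈ E := fun f hf i =>
    Finset.mem_biUnion.2 ⟨f, hf, Finset.mem_image_of_mem _ (Finset.mem_univ i)⟩
  have : Nonempty (ChaseDom I) := I.nonempty.map ChaseDom.base
  let back : ℕ → ChaseDom I := Function.invFunOn idx E
  have hback : ∀ d ∈ E, back (idx d) = d := fun d hd => hinj.leftInvOn_invFunOn hd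
  obtain ⟨v, hv⟩ := hIJ (s.image atom) (by
    intro a ha x hx
    obtain ⟨f, hf, rfl⟩ := Finset.mem_image.1 ha
    obtain ⟨i, hi⟩ := hx
    change term (f.args i) = FOTerm.var x at hi
    have hE' := hidx _ (hmem f hf i)
    revert hi hE'
    cases f.args i <;> simp only [term, FOTerm.var.injEq, reduceCtorEq, false_implies] <;>
      (rintro rfl; exact id)) (by
    refine ⟨fun x => (back x).proj, fun a ha => ?_⟩
    obtain ⟨f, hf, rfl⟩ := Finset.mem_image.1 ha
    have : (fun i => I.eval (fun x => (back x).proj) (term (f.args i))) =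
        fun i => (f.args i).proj := by
      funext i
      have := hback _ (hmem f hf i)
      revert this
      cases f.args i with
      | const k => exact fun _ => rfl
      | base d => exact fun h => congrArg ChaseDom.proj h
      | null n r v x => exact fun h => congrArg ChaseDom.proj h
    change I.rel f.pred fun i => I.eval (fun x => (back x).proj) (term (f.args i))
    rw [this]
    exact (hsF f hf).2)
  exact ⟨fun d => J.eval v (term d), fun k => rfl,
    fun f hf => hv _ (Finset.mem_image_of_mem atom hf)⟩

end Chase

/-! ### Conjunctions of queries, and finiteness of the set of small atoms. -/

section Conjunction

variable {σ : Signature.{u}}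

/-- Renaming of the variables of an atom. -/
def Atom.rename (ρ : ℕ → ℕ) (a : Atom σ) : Atom σ :=
  ⟨a.pred, fun i => (a.args i).value FOTerm.const fun x => FOTerm.var (ρ x)⟩

theorem Interp.rel_rename (I : Interp σ) (ρ : ℕ → ℕ) (v : ℕ → I.Dom) (a : Atom σ) :
    (I.rel (a.rename ρ).pred fun i => I.eval v ((a.rename ρ).args i)) ↔
      I.rel a.pred fun i => I.eval (fun x => v (ρ x)) (a.args i) := by
  have : (fun i => I.eval v ((a.rename ρ).args i)) =
      fun i => I.eval (fun x => v (ρ x)) (a.args i) := by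
    funext i
    change I.eval v ((a.args i).value _ _) = _
    cases a.args i <;> rfl
  exact Iff.of_eq (congrArg (I.rel a.pred) this)

theorem exists_conj_pair (F G : CSF σ) :
    ∃ H : CSF σ, ∀ I : Interp σ, I.SatEx H ↔ I.SatEx F ∧ I.SatEx G := by
  classical
  -- Even and odd names keep the two existential closures apart.
  refine ⟨F.image (Atom.rename fun x => 2 * x) ∪ G.image (Atom.rename fun x => 2 * x + 1),
    fun I => ⟨?_, ?_⟩⟩
  · rintro ⟨v, hv⟩
    exact ⟨⟨_, fun a ha => (I.rel_rename _ v a).1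
        (hv _ (Finset.mem_union_left _ (Finset.mem_image_of_mem _ ha)))⟩,
      ⟨_, fun a ha => (I.rel_rename _ v a).1
        (hv _ (Finset.mem_union_right _ (Finset.mem_image_of_mem _ ha)))⟩⟩
  · rintro ⟨⟨v, hv⟩, ⟨w, hw⟩⟩
    refine ⟨fun x => if x % 2 = 0 then v (x / 2) else w (x / 2), fun a ha => ?_⟩
    rcases Finset.mem_union.1 ha with ha | ha <;> obtain ⟨b, hb, rfl⟩ := Finset.mem_image.1 ha
    · refine (I.rel_rename _ _ b).2 (I.rel_congr (fun x _ => ?_) (hv b hb))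
      simp
    · refine (I.rel_rename _ _ b).2 (I.rel_congr (fun x _ => ?_) (hw b hb))
      have h1 : (2 * x + 1) % 2 ≠ 0 := by omega
      have h2 : (2 * x + 1) / 2 = x := by omega
      simp only [h1, h2, if_false]

/-- A finite conjunction of Boolean conjunctive queries is a Boolean conjunctive query. -/
theorem exists_conj (T : Finset (CSF σ)) :
    ∃ H : CSF σ, ∀ I : Interp σ, I.SatEx H ↔ ∀ q ∈ T, I.SatEx q := by
  classical
  induction T using Finset.induction_on with
  | empty =>
    refine ⟨∅, fun I => ⟨fun _ q hq => by simp at hq, fun _ => ?_⟩⟩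
    exact ⟨fun _ => I.nonempty.some, fun a ha => by simp at ha⟩
  | insert q T _ ih =>
    obtain ⟨H, hH⟩ := ih
    obtain ⟨H', hH'⟩ := exists_conj_pair q H
    exact ⟨H', fun I => by rw [hH', hH, Finset.forall_mem_insert]⟩

theorem finite_atoms_vars_lt [Finite σ.Pred] [Finite σ.Const] (N : ℕ) :
    {a : Atom σ | ∀ x ∈ a.vars, x < N}.Finite := by
  let mk : (Σ p : σ.Pred, Fin (σ.arity p) → σ.Const ⊕ Fin N) → Atom σ := fun b =>
    ⟨b.1, fun i => Sum.elim FOTerm.const (fun x => FOTerm.var x) (b.2 i)⟩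
  refine (Set.finite_range mk).subset ?_
  rintro ⟨p, t⟩ ha
  have : ∀ i, ∃ y : σ.Const ⊕ Fin N, Sum.elim FOTerm.const (fun x => FOTerm.var x) y = t i := by
    intro i
    cases hi : t i with
    | const k => exact ⟨Sum.inl k, rfl⟩
    | var x => exact ⟨Sum.inr ⟨x, ha x ⟨i, hi⟩⟩, rfl⟩
  choose y hy using this
  exact ⟨⟨p, y⟩, by simp only [mk, hy]⟩

end Conjunction

end ExRule

/-! ### The rewriting. -/

open ExRule in
theorem mainTheorem2 (σ : ExRule.Signature.{u}) [Finite σ.Pred] [Finite σ.Const]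
    (R : Set (ExRule.Rule σ)) (hfin : R.Finite)
    (hclr : ∀ r ∈ R, r.IsConnectedLinear) :
    ExRule.IsFus R := by
  classical
  intro Q
  obtain ⟨A, hA⟩ : ∃ A, ∀ p, σ.arity p ≤ A := by
    obtain ⟨A, hA⟩ := (Set.finite_range σ.arity).bddAbove
    exact ⟨A, fun p => hA ⟨p, rfl⟩⟩
  obtain ⟨K, hKR, hKQ⟩ : ∃ K, (∀ r ∈ R, r.body.card ≤ K) ∧ ∀ q ∈ Q, q.card ≤ K := by
    obtain ⟨K, hK⟩ := (hfin.image fun r => r.body.card).bddAbove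
    exact ⟨max K (Q.sup Finset.card), fun r hr => le_max_of_le_left (hK ⟨r, hr, rfl⟩),
      fun q hq => le_max_of_le_right (Finset.le_sup hq)⟩
  let S : Finset (CSF σ) := (finite_atoms_vars_lt (σ := σ) (K * A)).toFinset.powerset
  choose conj hconj using exists_conj (σ := σ)
  refine ⟨(S.powerset.filter fun T : Finset (CSF σ) => Entails R (T : Set (CSF σ)) Q).image conj, fun D => ⟨?_, ?_⟩⟩
  · intro h J hJR hJD
    obtain ⟨q, hq, hJq⟩ := h J (fun r hr => hr.elim) hJD
    obtain ⟨T, hT, rfl⟩ := Finset.mem_image.1 hq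
    exact (Finset.mem_filter.1 hT).2 J hJR ((hconj T J).1 hJq)
  · intro h I _ hID
    -- The disjunct true in `I` is the conjunction of all small queries true in `I`.
    refine ⟨conj (S.filter I.SatEx), Finset.mem_image_of_mem _ (Finset.mem_filter.2
      ⟨Finset.mem_powerset.2 (Finset.filter_subset _ _), fun J hJR hJT => ?_⟩),
      (hconj _ I).2 fun q hq => (Finset.mem_filter.1 hq).2⟩
    obtain ⟨q, hq, hIq⟩ := h (chase I R) (fun r hr => chase_satRule I R hr)
      fun F hF => chase_satEx I R (hID F hF)
    refine ⟨q, hq, chase_satEx_transfer hclr hKR hJR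
      (finHom_chaseStage_zero hA fun q' hq' hI => hJT q' ?_) (hKQ q hq) hIq⟩
    refine Finset.mem_coe.2 (Finset.mem_filter.2 ⟨Finset.mem_powerset.2 fun a ha => ?_, hI⟩)
    exact (Set.Finite.mem_toFinset _).2 (hq' a ha)
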